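/- Let $n\ge 1$ and let $P$ be the transition matrix on the symmetric group $S_n$ of the random-to-random insertion shuffle of $n$ cards: at each step a card is chosen uniformly at random, removed from the deck, and re-inserted at an independent, uniformly random one of the $n$ positions. For $\epsilon\in(0,1)$ let $$T_{\rm mix}^{(n)}(\epsilon)=\min\Bigl\{t\ge 0:\ \tfrac12\sum_{y\in S_n}\Bigl|P^t(x,y)-\tfrac1{n!}\Bigr|\le\epsilon\ \text{ for all } x\in S_n\Bigr\}$$ be the $\epsilon$-mixing time, that is, the first time at which the total variation distance to the uniform distribution is at most $\epsilon$ from every starting state. Then for every $\epsilon\in(0,1)$, $$\limsup_{n\to\infty}\frac{T_{\rm mix}^{(n)}(\epsilon)}{1.5324\, n\log n}\le 1 .$$ -/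

import Mathlib

open Filter
open scoped ENNReal

noncomputable section

namespace RandomToRandom

/-- Total variation distance `½ ∑ |μ x - ν x|` between two probability vectors on a finite set. -/
def tvDist {V : Type*} [Fintype V] (μ ν : V → ℝ) : ℝ :=
  (1 / 2) * ∑ x, |μ x - ν x|

/-- The uniform distribution on a finite set. -/
def uniform (V : Type*) [Fintype V] : V → ℝ :=
  fun _ => 1 / (Fintype.card V : ℝ)

/-- The permutation of the `n` positions of a deck that results from taking out the card in
position `p` and re-inserting it so that it ends in position `q`, all other cards keeping
their relative order: `p ↦ q`, and the `k`-th position other than `p` goes to the `k`-th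
position other than `q`. -/
def relocate : {n : ℕ} → Fin n → Fin n → Equiv.Perm (Fin n)
  | 0, p, _ => p.elim0
  | _ + 1, p, q => (finSuccEquiv' p).trans (finSuccEquiv' q).symm

/-- The order of a deck is a permutation `π`, with `π i` the position of card `i`. `moveCard c q π`
is the deck obtained from `π` by removing card `c` and re-inserting it at position `q`. -/
def moveCard {n : ℕ} (c q : Fin n) (π : Equiv.Perm (Fin n)) : Equiv.Perm (Fin n) :=
  relocate (π c) q * π

/-- Transition matrix of the random-to-random insertion shuffle of `n` cards: the card and the
position where it is re-inserted are independent and uniform. -/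
def transition (n : ℕ) : Matrix (Equiv.Perm (Fin n)) (Equiv.Perm (Fin n)) ℝ :=
  fun x y =>
    ((Finset.univ.filter fun m : Fin n × Fin n => moveCard m.1 m.2 x = y).card : ℝ) / (n : ℝ) ^ 2

/-- The `ε`-mixing time: the least `t` such that `‖P ^ t (x, ·) - U‖ ≤ ε` for all starting states
`x` (it would be `⊤` if there were no such `t`). -/
def mixingTime (n : ℕ) (ε : ℝ) : ℕ∞ :=
  ⨅ (t : ℕ) (_ : ∀ x : Equiv.Perm (Fin n),
    tvDist ((transition n ^ t) x) (uniform (Equiv.Perm (Fin n))) ≤ ε), (t : ℕ∞)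

end RandomToRandom

end

/-! The chain is compared with random transpositions. Let `R` be `relocateSum` (n² times the
transition operator) and `S` the sum `swapSum` over ordered pairs of positions. The core is the form
inequality 2R ≤ n² + S (`relocateSum_le_swapSum`), by induction on n. Inserting the card in hand,
summed over gaps, is the adjoint of taking a card out, and R is the composition of the two.
Insertion intertwines 2R − n² − S with its analogue for one card less, since the terms exchanging
the card in hand cancel (`insertSum_relocateSum`, `swapSum_option`). An eigenvector with positive
eigenvalue must then be killed by insertion, so R vanishes on it, and S ≥ −n² gives a contradiction.

The eigenvalues of S are bounded without representation theory: symmetrizing over a largest set A of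
positions that does not kill f plays the role of the first row of a Young diagram
(`eigenvalue_swapSumOn_le`). If symmetrization over every set of more than n − k positions kills f,
its Rayleigh quotient for the shuffle is at most `levelBound n k`.

Having all k-position marginals zero is at most C(n,k)·n!/(n−k)! linear conditions, which bounds the
number of eigenvalues above `levelBound n (k + 1)`. By Cauchy–Schwarz and invariance under
relabelling cards, 4‖P^t − U‖² ≤ tr P^(2t) − 1, and the trace is at most 1 plus a geometric series
with ratio exp(4 − (log n)/2). -/

namespace RandomToRandom

open Matrix Equiv

/-! ### Quadratic forms and eigenvalues -/

/-- If every eigenvalue of a symmetric operator on an invariant subspace is at most `c`, then so is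
its quadratic form on that subspace. -/
theorem dotProduct_le_of_eigenvalue_le {Ω : Type*} [Fintype Ω]
    (A : (Ω → ℝ) →ₗ[ℝ] (Ω → ℝ)) (hA : ∀ f g, A f ⬝ᵥ g = f ⬝ᵥ A g)
    (W : Submodule ℝ (Ω → ℝ)) (hW : ∀ f ∈ W, A f ∈ W) (c : ℝ)
    (h : ∀ f ∈ W, f ≠ 0 → ∀ μ : ℝ, A f = μ • f → μ ≤ c) (f : Ω → ℝ) (hf : f ∈ W) :
    f ⬝ᵥ A f ≤ c * (f ⬝ᵥ f) := by
  classical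
  -- The spectral theorem needs the ℓ² inner product, whereas the function space carries the sup
  -- norm.
  let e : EuclideanSpace ℝ Ω ≃ₗ[ℝ] (Ω → ℝ) := WithLp.linearEquiv 2 ℝ (Ω → ℝ)
  have inn : ∀ u v : EuclideanSpace ℝ Ω, inner ℝ u v = e u ⬝ᵥ e v := by
    intro u v
    simp [PiLp.inner_apply, dotProduct, e, mul_comm]
  let V : Submodule ℝ (EuclideanSpace ℝ Ω) := W.comap e.toLinearMap
  let T : EuclideanSpace ℝ Ω →ₗ[ℝ] EuclideanSpace ℝ Ω :=
    e.symm.toLinearMap ∘ₗ A ∘ₗ e.toLinearMap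
  have hT : T.IsSymmetric := by
    intro u v
    simp [inn, T, hA]
  have hV : ∀ v ∈ V, T v ∈ V := by
    intro v hv
    simpa [V, T] using hW _ hv
  have hTV := hT.restrict_invariant hV
  set n := Module.finrank ℝ V with hn
  let b := hTV.eigenvectorBasis hn.symm
  let u : V := ⟨e.symm f, by simpa [V] using hf⟩
  have key : ∀ i, hTV.eigenvalues hn.symm i ≤ c := by
    intro i
    have hb := hTV.apply_eigenvectorBasis hn.symm i
    refine h (e (b i)) (b i).2 ?_ _ ?_
    · intro h0
      have : (b i : EuclideanSpace ℝ Ω) = 0 := by simpa using h0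
      exact (b.orthonormal.ne_zero i) (by ext1; exact this)
    · have h2 : T (b i : EuclideanSpace ℝ Ω)
          = hTV.eigenvalues hn.symm i • (b i : EuclideanSpace ℝ Ω) :=
        congrArg Subtype.val hb
      have := congrArg e h2
      simpa only [T, LinearMap.comp_apply, LinearEquiv.coe_coe, LinearEquiv.apply_symm_apply,
        map_smul] using this
  have h1 : inner ℝ u (T.restrict hV u) ≤ c * inner ℝ u u := by
    rw [← b.sum_inner_mul_inner u (T.restrict hV u), ← b.sum_inner_mul_inner u u, Finset.mul_sum]
    refine Finset.sum_le_sum fun i _ => ?_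
    have : inner ℝ (b i) (T.restrict hV u)
        = hTV.eigenvalues hn.symm i * inner ℝ (b i) u := by
      rw [← hTV, hTV.apply_eigenvectorBasis hn.symm i]
      simp [b, inner_smul_left]
    rw [this, real_inner_comm (b i) u]
    nlinarith [mul_self_nonneg (inner ℝ (b i) u), key i]
  have e1 : inner ℝ u (T.restrict hV u) = f ⬝ᵥ A f := by
    rw [Submodule.coe_inner, inn]; simp [u, T]
  have e2 : inner ℝ u u = f ⬝ᵥ f := by
    rw [Submodule.coe_inner, inn]; simp [u]
  rwa [e1, e2] at h1

/-! ### Insertion, deletion and transposition operators -/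

/-- The operator `f ↦ ∑ i, f ∘ g i`. -/
def sumPullback {ι X Y : Type*} [Fintype ι] (g : ι → Y → X) : (X → ℝ) →ₗ[ℝ] (Y → ℝ) :=
  ∑ i, LinearMap.funLeft ℝ ℝ (g i)

theorem sumPullback_apply {ι X Y : Type*} [Fintype ι] (g : ι → Y → X) (f : X → ℝ) (y : Y) :
    sumPullback g f y = ∑ i, f (g i y) := by
  simp [sumPullback, LinearMap.funLeft]

/-- The sum over all pairs of labels of the operators that exchange the two labels. -/
def swapSum (C β : Type*) [Fintype β] [DecidableEq β] : ((C ≃ β) → ℝ) →ₗ[ℝ] ((C ≃ β) → ℝ) :=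
  sumPullback fun (i : β × β) y => y.trans (swap i.1 i.2)

/-- The random-to-random operator, times the square of the number of cards. -/
def relocateSum (C : Type*) (n : ℕ) : ((C ≃ Fin n) → ℝ) →ₗ[ℝ] ((C ≃ Fin n) → ℝ) :=
  sumPullback fun (i : Fin n × Fin n) y => y.trans (relocate i.1 i.2)

/-- Sum over all ways of inserting the card in hand. -/
def insertSum (C : Type*) (n : ℕ) :
    ((C ≃ Fin (n + 1)) → ℝ) →ₗ[ℝ] ((C ≃ Option (Fin n)) → ℝ) :=
  sumPullback fun (q : Fin (n + 1)) y => y.trans (finSuccEquiv' q).symm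

/-- Sum over all ways of taking a card in hand. -/
def deleteSum (C : Type*) (n : ℕ) :
    ((C ≃ Option (Fin n)) → ℝ) →ₗ[ℝ] ((C ≃ Fin (n + 1)) → ℝ) :=
  sumPullback fun (p : Fin (n + 1)) y => y.trans (finSuccEquiv' p)

/-- Relocate a card other than the one in hand. -/
def relocateSumOption (C : Type*) (n : ℕ) :
    ((C ≃ Option (Fin n)) → ℝ) →ₗ[ℝ] ((C ≃ Option (Fin n)) → ℝ) :=
  sumPullback fun (i : Fin n × Fin n) y => y.trans (optionCongr (relocate i.1 i.2))

/-- Exchange the card in hand with another one. -/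
def handSwapSum (C : Type*) (n : ℕ) :
    ((C ≃ Option (Fin n)) → ℝ) →ₗ[ℝ] ((C ≃ Option (Fin n)) → ℝ) :=
  sumPullback fun (i : Fin n) y => y.trans (swap none (some i))

/-- Transpositions of cards other than the one in hand. -/
def swapSumOption (C : Type*) (n : ℕ) :
    ((C ≃ Option (Fin n)) → ℝ) →ₗ[ℝ] ((C ≃ Option (Fin n)) → ℝ) :=
  sumPullback fun (i : Fin n × Fin n) y => y.trans (optionCongr (swap i.1 i.2))

theorem relocateSum_succ (C : Type*) (n : ℕ) (f : (C ≃ Fin (n + 1)) → ℝ) :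
    relocateSum C (n + 1) f = deleteSum C n (insertSum C n f) := by
  ext x
  simp only [relocateSum, deleteSum, insertSum, sumPullback_apply, Fintype.sum_prod_type]
  rfl

theorem dotProduct_sumPullback {ι X Y : Type*} [Fintype ι] [Fintype X] [Fintype Y]
    (e : ι → Y ≃ X) (f : X → ℝ) (u : Y → ℝ) :
    u ⬝ᵥ sumPullback (fun i => e i) f = sumPullback (fun i => (e i).symm) u ⬝ᵥ f := by
  simp only [dotProduct, sumPullback_apply, Finset.mul_sum, Finset.sum_mul]
  rw [Finset.sum_comm, Finset.sum_comm (s := (Finset.univ : Finset X))]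
  refine Finset.sum_congr rfl fun i _ => ?_
  exact Fintype.sum_equiv (e i) _ _ (by simp)

/-- Relabelling, as a permutation of the set of labellings. -/
def transRight (C : Type*) {β γ : Type*} (e : β ≃ γ) : (C ≃ β) ≃ (C ≃ γ) where
  toFun x := x.trans e
  invFun x := x.trans e.symm
  left_inv x := by ext; simp
  right_inv x := by ext; simp

section
variable {C : Type*} [Fintype C] [DecidableEq C]

theorem dotProduct_insertSum (n : ℕ) (f : (C ≃ Fin (n + 1)) → ℝ) (u : (C ≃ Option (Fin n)) → ℝ) :
    u ⬝ᵥ insertSum C n f = deleteSum C n u ⬝ᵥ f :=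
  dotProduct_sumPullback (fun q => transRight C (finSuccEquiv' q).symm) f u

theorem swapSum_symm {β : Type*} [Fintype β] [DecidableEq β] (f g : (C ≃ β) → ℝ) :
    swapSum C β f ⬝ᵥ g = f ⬝ᵥ swapSum C β g := by
  have := dotProduct_sumPullback (fun i : β × β => transRight C (swap i.1 i.2)) g f
  simp only [transRight] at this
  exact this.symm

theorem relocateSum_dotProduct_self (n : ℕ) (f : (C ≃ Fin (n + 1)) → ℝ) :
    f ⬝ᵥ relocateSum C (n + 1) f = insertSum C n f ⬝ᵥ insertSum C n f := by
  rw [dotProduct_insertSum, relocateSum_succ, dotProduct_comm]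

theorem relocateSum_symm (n : ℕ) (f g : (C ≃ Fin (n + 1)) → ℝ) :
    relocateSum C (n + 1) f ⬝ᵥ g = f ⬝ᵥ relocateSum C (n + 1) g := by
  rw [relocateSum_succ, relocateSum_succ, ← dotProduct_insertSum, dotProduct_comm f,
    ← dotProduct_insertSum, dotProduct_comm]

end

theorem insertSum_swapSum (C : Type*) (n : ℕ) (f : (C ≃ Fin (n + 1)) → ℝ) :
    insertSum C n (swapSum C _ f) = swapSum C _ (insertSum C n f) := by
  ext y
  simp only [swapSum, insertSum, sumPullback_apply]
  conv_rhs => rw [Finset.sum_comm]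
  refine Finset.sum_congr rfl fun q _ => ?_
  refine Fintype.sum_equiv (ι := Fin (n + 1) × Fin (n + 1))
    ((finSuccEquiv' q).prodCongr (finSuccEquiv' q)) _ _ fun i => ?_
  congr 1
  ext c : 1
  have := (finSuccEquiv' q).symm.injective.map_swap (finSuccEquiv' q i.1) (finSuccEquiv' q i.2)
    (y c)
  simpa using this.symm

/-- The pairs of labels split by whether they involve `none`: the factor 2 counts both orders, and
the last `f` is the pair (`none`, `none`). -/
theorem swapSum_option (C : Type*) (n : ℕ) (f : (C ≃ Option (Fin n)) → ℝ) :
    swapSum C _ f = swapSumOption C n f + (2 : ℝ) • handSwapSum C n f + f := by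
  ext y
  simp only [swapSum, swapSumOption, handSwapSum, sumPullback_apply, Fintype.sum_prod_type,
    Fintype.sum_option, Pi.add_apply, Pi.smul_apply, smul_eq_mul]
  simp only [optionCongr_swap, swap_self, Finset.sum_add_distrib,
    Equiv.swap_comm (some _) (none : Option (Fin n))]
  have : y.trans (Equiv.refl _) = y := by ext; simp
  rw [this]
  ring


/-! ### The intertwining relation for insertion -/

/-- The labelling obtained by putting the card in hand into the gap `j` of the remaining cards other
than `i`, and then card `i` into the gap `r`. -/
def doubleInsert {m : ℕ} (i : Fin (m + 1)) (r : Fin (m + 2)) (j : Fin (m + 1)) :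
    Option (Fin (m + 1)) ≃ Fin (m + 2) :=
  ((swap none (some i)).trans (optionCongr (relocate i j))).trans (finSuccEquiv' r).symm

theorem relocate_self {n : ℕ} (i j : Fin n) : relocate i j i = j := by
  cases n with
  | zero => exact i.elim0
  | succ n => simp [relocate]

theorem relocate_succAbove {n : ℕ} (i j : Fin (n + 1)) (k : Fin n) :
    relocate i j (i.succAbove k) = j.succAbove k := by
  simp [relocate]

theorem relocate_same {n : ℕ} (i : Fin n) : relocate i i = Equiv.refl _ := by
  cases n with
  | zero => exact i.elim0
  | succ n => simp [relocate]

section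
variable {m : ℕ} (i : Fin (m + 1)) (r : Fin (m + 2)) (j : Fin (m + 1))

theorem doubleInsert_none : doubleInsert i r j none = r.succAbove j := by
  simp [doubleInsert, relocate_self]

theorem doubleInsert_some : doubleInsert i r j (some i) = r := by
  simp [doubleInsert]

theorem doubleInsert_some_succAbove (k : Fin m) :
    doubleInsert i r j (some (i.succAbove k)) = r.succAbove (j.succAbove k) := by
  have : swap none (some i) (some (i.succAbove k)) = some (i.succAbove k) :=
    swap_apply_of_ne_of_ne (by simp) (by simp [Fin.succAbove_ne])
  simp [doubleInsert, this, relocate_succAbove]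

theorem eq_doubleInsert {e : Option (Fin (m + 1)) ≃ Fin (m + 2)} (h1 : e none = r.succAbove j)
    (h2 : e (some i) = r)
    (h3 : ∀ k, e (some (i.succAbove k)) = r.succAbove (j.succAbove k)) :
    e = doubleInsert i r j := by
  ext1 a
  rcases a with _ | a
  · rw [h1, doubleInsert_none]
  · rcases Fin.eq_self_or_eq_succAbove i a with rfl | ⟨k, rfl⟩
    · rw [h2, doubleInsert_some]
    · rw [h3, doubleInsert_some_succAbove]

theorem insert_delete_insert (q : Fin (m + 2)) :
    ((finSuccEquiv' q).symm.trans (finSuccEquiv' (q.succAbove i))).trans (finSuccEquiv' r).symm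
      = doubleInsert i r (i.predAbove q) := by
  apply eq_doubleInsert
  · have h := finSuccEquiv'_succAbove (q.succAbove i) (i.predAbove q)
    rw [Fin.succAbove_succAbove_predAbove] at h
    simp [h]
  · simp
  · intro k
    have h : finSuccEquiv' (q.succAbove i) (q.succAbove (i.succAbove k))
        = some ((i.predAbove q).succAbove k) := by
      rw [← Fin.succAbove_succAbove_succAbove_predAbove]
      exact finSuccEquiv'_succAbove _ _
    simp [h]

theorem swap_insert :
    (swap none (some i)).trans (finSuccEquiv' r).symm = doubleInsert i r i := by
  simp [doubleInsert, relocate_same]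

/-- The same two cards are put back in the opposite order: card `i` first, then the card in hand. -/
theorem relocate_insert :
    (optionCongr (relocate i (j.predAbove r))).trans (finSuccEquiv' (r.succAbove j)).symm
      = doubleInsert i r j := by
  apply eq_doubleInsert
  · simp
  · simp [relocate_self, Fin.succAbove_succAbove_predAbove]
  · intro k
    simp [relocate_succAbove, Fin.succAbove_succAbove_succAbove_predAbove]

end

/-- The two gaps on either side of `i` merge when card `i` is taken out, so the value at `i` is
counted twice. -/
theorem sum_predAbove {n : ℕ} (i : Fin n) (F : Fin n → ℝ) :
    ∑ q : Fin (n + 1), F (i.predAbove q) = ∑ j, F j + F i := by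
  rw [Fin.sum_univ_succAbove _ i.castSucc, Fin.predAbove_castSucc_self, add_comm]
  simp [Fin.predAbove_succAbove]

/-- Exchanging the roles of two holes. -/
def holeSwap (n : ℕ) : Fin (n + 1) × Fin n ≃ Fin (n + 1) × Fin n where
  toFun x := (x.1.succAbove x.2, x.2.predAbove x.1)
  invFun x := (x.1.succAbove x.2, x.2.predAbove x.1)
  left_inv x := by
    simp [Fin.succAbove_succAbove_predAbove, Fin.predAbove_predAbove_succAbove]
  right_inv x := by
    simp [Fin.succAbove_succAbove_predAbove, Fin.predAbove_predAbove_succAbove]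

/-- After the card in hand is inserted and card `i` is taken out, only the gap among the other cards
matters. The gap counted twice accounts for the exchange term; in the rest the two insertions are
reordered by `holeSwap`. -/
theorem sum_insert_delete_insert {n : ℕ} (i : Fin n)
    (F : (Option (Fin n) ≃ Fin (n + 1)) → ℝ) :
    ∑ q : Fin (n + 1), ∑ r : Fin (n + 1),
      F (((finSuccEquiv' q).symm.trans (finSuccEquiv' (q.succAbove i))).trans
        (finSuccEquiv' r).symm) =
    ∑ r : Fin (n + 1), F ((swap none (some i)).trans (finSuccEquiv' r).symm) +
    ∑ j : Fin n, ∑ r : Fin (n + 1),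
      F ((optionCongr (relocate i j)).trans (finSuccEquiv' r).symm) := by
  cases n with
  | zero => exact i.elim0
  | succ m =>
    simp only [insert_delete_insert, swap_insert]
    rw [sum_predAbove i (fun j => ∑ r, F (doubleInsert i r j)), add_comm]
    congr 1
    rw [Finset.sum_comm, Finset.sum_comm (s := (Finset.univ : Finset (Fin (m + 1)))),
      ← Fintype.sum_prod_type', ← Fintype.sum_prod_type']
    refine Fintype.sum_equiv (holeSwap (m + 1)) _ _ fun x => ?_
    simp [holeSwap, relocate_insert]

theorem insertSum_relocateSum (C : Type*) (n : ℕ) (f : (C ≃ Fin (n + 1)) → ℝ) :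
    insertSum C n (relocateSum C (n + 1) f) =
      ((n : ℝ) + 1) • insertSum C n f + handSwapSum C n (insertSum C n f)
        + relocateSumOption C n (insertSum C n f) := by
  rw [relocateSum_succ]
  ext y
  simp only [insertSum, deleteSum, relocateSumOption, handSwapSum, sumPullback_apply,
    Pi.add_apply, Pi.smul_apply, smul_eq_mul, Fintype.sum_prod_type, Equiv.trans_assoc]
  have h : ∀ i : Fin n, _ := fun i =>
    sum_insert_delete_insert i (fun e => f (y.trans e))
  simp only [Equiv.trans_assoc] at h
  have h' := Finset.sum_congr (rfl : (Finset.univ : Finset (Fin n)) = _) fun i _ => h i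
  rw [Finset.sum_add_distrib] at h'
  rw [add_assoc, ← h', Finset.sum_comm, ← Nat.cast_succ]
  -- Deleting at `p = q` undoes the insertion and yields the multiple n + 1; any other `p` takes out
  -- some card `i`.
  have h0 : ∀ q : Fin (n + 1), ∑ p : Fin (n + 1), ∑ r : Fin (n + 1),
      f (y.trans ((finSuccEquiv' q).symm.trans ((finSuccEquiv' p).trans (finSuccEquiv' r).symm)))
      = ∑ r : Fin (n + 1), f (y.trans (finSuccEquiv' r).symm) + ∑ i : Fin n, ∑ r : Fin (n + 1),
        f (y.trans ((finSuccEquiv' q).symm.trans ((finSuccEquiv' (q.succAbove i)).trans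
          (finSuccEquiv' r).symm))) := by
    intro q
    rw [Fin.sum_univ_succAbove _ q]
    congr 1
    refine Finset.sum_congr rfl fun r _ => ?_
    rw [← Equiv.trans_assoc (finSuccEquiv' q).symm]
    simp
  rw [Finset.sum_comm]
  simp only [h0]
  rw [Finset.sum_add_distrib, Finset.sum_comm (s := (Finset.univ : Finset (Fin n)))]
  simp

/-! ### Comparison with random transpositions -/

/-- Restricting `F` to the orbit of each `y` under permutations of the positions outside the hand
covers every labelling n! times. This carries form inequalities on `Perm (Fin n)` over to decks with
one card in hand. -/
theorem sum_dotProduct_restrict (C : Type*) [Fintype C] [DecidableEq C] {ι : Type*} [Fintype ι]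
    (n : ℕ) (g : ι → Perm (Fin n)) (F : (C ≃ Option (Fin n)) → ℝ) :
    ∑ y : C ≃ Option (Fin n),
      (fun π : Perm (Fin n) => F (y.trans (optionCongr π))) ⬝ᵥ
        sumPullback (fun (i : ι) π => π.trans (g i))
          (fun π : Perm (Fin n) => F (y.trans (optionCongr π)))
      = Fintype.card (Perm (Fin n)) *
        (F ⬝ᵥ sumPullback (fun (i : ι) y => y.trans (optionCongr (g i))) F) := by
  simp only [dotProduct, sumPullback_apply]
  rw [Finset.sum_comm]
  rw [← nsmul_eq_mul, ← Finset.card_univ, ← Finset.sum_const]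
  refine Finset.sum_congr rfl fun π _ => ?_
  refine Fintype.sum_equiv (transRight C (optionCongr π)) _ _ fun y => ?_
  simp [transRight, Equiv.trans_assoc, optionCongr_trans]

theorem relocateSumOption_le (C : Type*) [Fintype C] [DecidableEq C] (n : ℕ)
    (h : ∀ f : (Fin n ≃ Fin n) → ℝ, 2 * (f ⬝ᵥ relocateSum (Fin n) n f) ≤
      (n : ℝ) ^ 2 * (f ⬝ᵥ f) + f ⬝ᵥ swapSum (Fin n) (Fin n) f)
    (F : (C ≃ Option (Fin n)) → ℝ) :
    2 * (F ⬝ᵥ relocateSumOption C n F) ≤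
      (n : ℝ) ^ 2 * (F ⬝ᵥ F) + F ⬝ᵥ swapSumOption C n F := by
  have h1 := sum_dotProduct_restrict C n (fun i : Fin n × Fin n => relocate i.1 i.2) F
  have h2 := sum_dotProduct_restrict C n (fun i : Fin n × Fin n => swap i.1 i.2) F
  have h3 := sum_dotProduct_restrict C n (fun _ : Unit => Equiv.refl _) F
  have e1 : sumPullback (fun (_ : Unit) (y : C ≃ Option (Fin n)) =>
      y.trans (optionCongr (Equiv.refl (Fin n)))) F = F := by
    ext y; simp [sumPullback_apply]
  have e2 : ∀ f : Perm (Fin n) → ℝ, sumPullback (fun (_ : Unit) (y : Perm (Fin n)) =>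
      y.trans (Equiv.refl (Fin n))) f = f := by
    intro f; ext y; simp [sumPullback_apply]
  simp only [e1, e2] at h3
  have hc : (0 : ℝ) < Fintype.card (Perm (Fin n)) := by exact_mod_cast Fintype.card_pos
  have hs := Finset.sum_le_sum fun (y : C ≃ Option (Fin n)) (_ : y ∈ Finset.univ) =>
    h (fun π : Perm (Fin n) => F (y.trans (optionCongr π)))
  rw [← Finset.mul_sum, Finset.sum_add_distrib, ← Finset.mul_sum] at hs
  erw [h1, h2, h3] at hs
  refine le_of_mul_le_mul_left ?_ hc
  unfold relocateSumOption swapSumOption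
  linarith

section
variable {C : Type*} [Fintype C] [DecidableEq C]

theorem abs_dotProduct_comp_le {X : Type*} [Fintype X] (e : X ≃ X) (f : X → ℝ) :
    |∑ x, f x * f (e x)| ≤ f ⬝ᵥ f := by
  have h1 : ∑ x, f (e x) * f (e x) = ∑ x, f x * f x := Equiv.sum_comp e fun x => f x * f x
  have h2 : ∑ x, |f x * f (e x)| ≤ ∑ x, (f x * f x + f (e x) * f (e x)) / 2 := by
    refine Finset.sum_le_sum fun x _ => ?_
    rw [abs_le]
    constructor <;> nlinarith [sq_nonneg (f x + f (e x)), sq_nonneg (f x - f (e x))]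
  rw [← Finset.sum_div, Finset.sum_add_distrib, h1] at h2
  refine (Finset.abs_sum_le_sum_abs _ _).trans (h2.trans ?_)
  simp [dotProduct]

/-- Each transposition acts isometrically, so each contributes at least −f·f. -/
theorem card_sq_mul_add_dotProduct_swapSum_nonneg {β : Type*} [Fintype β] [DecidableEq β] (f : (C ≃ β) → ℝ) :
    0 ≤ (Fintype.card β : ℝ) ^ 2 * (f ⬝ᵥ f) + f ⬝ᵥ swapSum C β f := by
  have h : f ⬝ᵥ swapSum C β f = ∑ i : β × β, ∑ x, f x * f (transRight C (swap i.1 i.2) x) := by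
    simp only [dotProduct, swapSum, sumPullback_apply, Finset.mul_sum]
    rw [Finset.sum_comm]
    rfl
  have h2 : ∑ _i : β × β, -(f ⬝ᵥ f) ≤ f ⬝ᵥ swapSum C β f := by
    rw [h]
    exact Finset.sum_le_sum fun i _ =>
      neg_le_of_abs_le (abs_dotProduct_comp_le (transRight C (swap i.1 i.2)) f)
  simp only [Finset.sum_const, Finset.card_univ, Fintype.card_prod, nsmul_eq_mul] at h2
  push_cast at h2
  linarith

end

/-- Comparison of the random-to-random shuffle with random transpositions. -/
theorem relocateSum_le_swapSum (n : ℕ) (f : (Fin n ≃ Fin n) → ℝ) :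
    2 * (f ⬝ᵥ relocateSum (Fin n) n f) ≤
      (n : ℝ) ^ 2 * (f ⬝ᵥ f) + f ⬝ᵥ swapSum (Fin n) (Fin n) f := by
  induction n with
  | zero => simp [relocateSum, swapSum, sumPullback]
  | succ n ih =>
    let C := Fin (n + 1)
    have hY := relocateSumOption_le C n ih
    let N : ℝ := ((n : ℝ) + 1) ^ 2
    let A : ((C ≃ Fin (n + 1)) → ℝ) →ₗ[ℝ] ((C ≃ Fin (n + 1)) → ℝ) :=
      (2 : ℝ) • relocateSum C (n + 1) - N • LinearMap.id - swapSum C (Fin (n + 1))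
    have hA : ∀ f, A f = (2 : ℝ) • relocateSum C (n + 1) f - N • f - swapSum C (Fin (n + 1)) f :=
      fun f => rfl
    have key := dotProduct_le_of_eigenvalue_le A (by
      intro f g
      simp only [hA, sub_dotProduct, smul_dotProduct, dotProduct_sub, dotProduct_smul,
        relocateSum_symm, swapSum_symm]) ⊤ (by simp) 0 (by
      intro g _ hg μ hμ
      by_contra! hpos
      rw [hA] at hμ
      set u := insertSum C n g with hu
      -- The exchanges with the hand cancel, and 2(n+1) − (n+1)² − 1 = −n²: what remains is the
      -- operator of the induction hypothesis, whose form is nonpositive.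
      have h1 : (2 : ℝ) • (((n : ℝ) + 1) • u + handSwapSum C n u + relocateSumOption C n u)
          - N • u - (swapSumOption C n u + (2 : ℝ) • handSwapSum C n u + u) = μ • u := by
        have := congrArg (insertSum C n) hμ
        simpa only [map_sub, map_smul, insertSum_relocateSum, insertSum_swapSum,
          swapSum_option, ← hu] using this
      have h2 := congrArg (fun v => u ⬝ᵥ v) h1
      simp only [dotProduct_sub, dotProduct_smul, dotProduct_add, smul_eq_mul] at h2
      have h3 := hY u
      have h4 : 0 ≤ u ⬝ᵥ u := by
        simpa using dotProduct_star_self_nonneg u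
      have h5 : u ⬝ᵥ u ≤ 0 := by
        have : μ * (u ⬝ᵥ u) ≤ 0 := by
          rw [← h2]; simp only [N]; linarith
        by_contra! h
        nlinarith
      have h6 : u = 0 := dotProduct_self_eq_zero.mp (le_antisymm h5 h4)
      -- With `R g = 0` the eigenvalue equation reads −N − S = μ on `g`, which S ≥ −N forbids.
      have h7 : relocateSum C (n + 1) g = 0 := by
        rw [relocateSum_succ, ← hu, h6, map_zero]
      have h8 := congrArg (fun v => g ⬝ᵥ v) hμ
      simp only [h7, dotProduct_sub, dotProduct_smul, smul_eq_mul, dotProduct_zero] at h8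
      have h9 := card_sq_mul_add_dotProduct_swapSum_nonneg g
      simp only [Fintype.card_fin] at h9
      push_cast at h9
      have h10 : 0 ≤ g ⬝ᵥ g := by simpa using dotProduct_star_self_nonneg g
      have h11 : g ⬝ᵥ g ≤ 0 := by
        have : μ * (g ⬝ᵥ g) ≤ 0 := by
          rw [← h8]; simp only [N]; linarith
        by_contra! h
        nlinarith
      exact hg (dotProduct_self_eq_zero.mp (le_antisymm h11 h10))) f trivial
    rw [hA] at key
    simp only [dotProduct_sub, dotProduct_smul, smul_eq_mul, N] at key
    push_cast
    linarith

/-! ### Eigenvalues of sums of transpositions -/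

section Levels
variable {α : Type*} [Fintype α] [DecidableEq α]

/-- The permutations that move only points of `A`. -/
def permsOn (A : Finset α) : Finset (Perm α) :=
  Finset.univ.filter fun h => ∀ i, i ∉ A → h i = i

theorem mem_permsOn {A : Finset α} {h : Perm α} : h ∈ permsOn A ↔ ∀ i, i ∉ A → h i = i := by
  simp [permsOn]

theorem permsOn_mono {A B : Finset α} (hAB : A ⊆ B) : permsOn A ⊆ permsOn B := by
  intro h hh
  rw [mem_permsOn] at *
  exact fun i hi => hh i fun hA => hi (hAB hA)

theorem one_mem_permsOn (A : Finset α) : 1 ∈ permsOn A := by simp [mem_permsOn]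

theorem mul_mem_permsOn {A : Finset α} {g h : Perm α} (hg : g ∈ permsOn A) (hh : h ∈ permsOn A) :
    g * h ∈ permsOn A := by
  rw [mem_permsOn] at *
  intro i hi
  rw [Perm.mul_apply, hh i hi, hg i hi]

theorem inv_mem_permsOn {A : Finset α} {g : Perm α} (hg : g ∈ permsOn A) : g⁻¹ ∈ permsOn A := by
  rw [mem_permsOn] at *
  intro i hi
  rw [Perm.inv_eq_iff_eq, hg i hi]

theorem apply_mem_iff_of_mem_permsOn {A U : Finset α} (hAU : A ⊆ U) {h : Perm α}
    (hh : h ∈ permsOn A) (i : α) : h i ∈ U ↔ i ∈ U := by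
  have aux : ∀ g ∈ permsOn A, ∀ i ∈ U, g i ∈ U := by
    intro g hg i hi
    rw [mem_permsOn] at hg
    by_contra hc
    have := hg (g i) fun hA => hc (hAU hA)
    rw [g.injective this] at hc
    exact hc hi
  refine ⟨fun hi => ?_, aux h hh i⟩
  simpa using aux _ (inv_mem_permsOn hh) _ hi

/-- Sum over the left translates by the permutations of `A`. -/
def symSum (A : Finset α) : (Perm α → ℝ) →ₗ[ℝ] (Perm α → ℝ) :=
  ∑ h ∈ permsOn A, LinearMap.funLeft ℝ ℝ (h * ·)

/-- Sum over the left translates by the transpositions in `U` (as ordered pairs, and including the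
trivial ones). -/
def swapSumOn (U : Finset α) : (Perm α → ℝ) →ₗ[ℝ] (Perm α → ℝ) :=
  ∑ i ∈ U, ∑ j ∈ U, LinearMap.funLeft ℝ ℝ (swap i j * ·)

theorem symSum_apply (A : Finset α) (f : Perm α → ℝ) (x : Perm α) :
    symSum A f x = ∑ h ∈ permsOn A, f (h * x) := by
  simp [symSum, LinearMap.funLeft]

omit [Fintype α] in
theorem swapSumOn_apply (U : Finset α) (f : Perm α → ℝ) (x : Perm α) :
    swapSumOn U f x = ∑ i ∈ U, ∑ j ∈ U, f (swap i j * x) := by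
  simp [swapSumOn, LinearMap.funLeft]

theorem symSum_swapSumOn {A U : Finset α} (hAU : A ⊆ U) (f : Perm α → ℝ) :
    symSum A (swapSumOn U f) = swapSumOn U (symSum A f) := by
  ext x
  simp only [symSum_apply, swapSumOn_apply]
  have : ∀ i ∈ U, ∑ j ∈ U, ∑ h ∈ permsOn A, f (h * (swap i j * x))
      = ∑ h ∈ permsOn A, ∑ j ∈ U, f (h * (swap i j * x)) := fun i _ => Finset.sum_comm
  rw [Finset.sum_congr rfl this, Finset.sum_comm (s := U)]
  refine Finset.sum_congr rfl fun h hh => ?_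
  symm
  refine Finset.sum_equiv h (fun i => (apply_mem_iff_of_mem_permsOn hAU hh i).symm) fun i _ => ?_
  refine Finset.sum_equiv h (fun i => (apply_mem_iff_of_mem_permsOn hAU hh i).symm) fun j _ => ?_
  rw [← mul_assoc, ← mul_assoc, mul_swap_eq_swap_mul]

theorem symSum_mul {A : Finset α} {h : Perm α} (hh : h ∈ permsOn A) (f : Perm α → ℝ)
    (x : Perm α) : symSum A f (h * x) = symSum A f x := by
  simp only [symSum_apply]
  refine Finset.sum_equiv (Equiv.mulRight h) (fun g => ?_) fun g _ => ?_
  · refine ⟨fun hg => mul_mem_permsOn hg hh, fun hg => ?_⟩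
    simpa using mul_mem_permsOn hg (inv_mem_permsOn hh)
  · simp [mul_assoc]

theorem symSum_symSum {A B : Finset α} (hAB : A ⊆ B) (f : Perm α → ℝ) :
    symSum B (symSum A f) = ((permsOn A).card : ℝ) • symSum B f := by
  ext x
  simp only [symSum_apply, Pi.smul_apply, smul_eq_mul]
  rw [Finset.sum_comm, ← nsmul_eq_mul, ← Finset.sum_const]
  refine Finset.sum_congr rfl fun h hh => ?_
  have hh' := permsOn_mono hAB hh
  refine Finset.sum_equiv (Equiv.mulLeft h) (fun g => ?_) fun g _ => ?_
  · refine ⟨fun hg => mul_mem_permsOn hh' hg, fun hg => ?_⟩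
    simpa using mul_mem_permsOn (inv_mem_permsOn hh') hg
  · simp [mul_assoc]

theorem symSum_eq_zero_of_subset {A B : Finset α} (hAB : A ⊆ B) {f : Perm α → ℝ}
    (hf : symSum A f = 0) : symSum B f = 0 := by
  have h := symSum_symSum hAB f
  rw [hf, map_zero] at h
  refine (smul_eq_zero.mp h.symm).resolve_left ?_
  exact_mod_cast (Finset.card_pos.mpr ⟨1, one_mem_permsOn A⟩).ne'

theorem symSum_symSum_of_subset {A B : Finset α} (hAB : A ⊆ B) {f : Perm α → ℝ}
    (hf : symSum B f = 0) : symSum B (symSum A f) = 0 := by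
  rw [symSum_symSum hAB, hf, smul_zero]

theorem symSum_symSum_of_disjoint {A B : Finset α} (hAB : Disjoint A B) {f : Perm α → ℝ}
    (hf : symSum B f = 0) : symSum B (symSum A f) = 0 := by
  ext x
  simp only [symSum_apply, Pi.zero_apply]
  rw [Finset.sum_comm]
  refine Finset.sum_eq_zero fun h hh => ?_
  have h1 : symSum B f (h * x) = 0 := by rw [hf]; rfl
  rw [← h1, symSum_apply]
  refine Finset.sum_congr rfl fun g hg => ?_
  rw [← mul_assoc, ← mul_assoc]
  have : Perm.Disjoint h g := by
    intro i
    rw [mem_permsOn] at hh hg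
    by_cases hi : i ∈ A
    · exact Or.inr (hg i (Finset.disjoint_left.mp hAB hi))
    · exact Or.inl (hh i hi)
  rw [this.commute.eq]

/-- The permutations of A ∪ {b} are the products of a permutation of A with `swap a b`, a ∈ A ∪ {b}.
By invariance the vanishing symmetrization is a multiple of the sum of `g` over these coset
representatives, and a = b contributes `g x`. -/
theorem sum_swap_mul {A : Finset α} {b : α} (hb : b ∉ A) {g : Perm α → ℝ}
    (hg : ∀ h ∈ permsOn A, ∀ x, g (h * x) = g x) (h0 : symSum (insert b A) g = 0) (x : Perm α) :
    ∑ a ∈ A, g (swap a b * x) = - g x := by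
  have h1 : symSum (insert b A) g x = 0 := by rw [h0]; rfl
  rw [symSum_apply] at h1
  have h2 : ∑ p ∈ insert b A ×ˢ permsOn A, g (swap p.1 b * x)
      = ∑ h ∈ permsOn (insert b A), g (h * x) := by
    refine Finset.sum_bij' (fun p _ => p.2 * swap p.1 b)
      (fun h _ => (h⁻¹ b, h * swap (h⁻¹ b) b)) ?_ ?_ ?_ ?_ ?_
    · rintro ⟨a, h⟩ hp
      rw [Finset.mem_product] at hp
      refine mul_mem_permsOn (permsOn_mono (Finset.subset_insert _ _) hp.2) ?_
      rw [mem_permsOn]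
      intro i hi
      refine swap_apply_of_ne_of_ne ?_ ?_
      · rintro rfl; exact hi hp.1
      · rintro rfl; exact hi (Finset.mem_insert_self _ _)
    · intro h hh
      have hb' : h⁻¹ b ∈ insert b A :=
        (apply_mem_iff_of_mem_permsOn subset_rfl (inv_mem_permsOn hh) b).mpr
          (Finset.mem_insert_self _ _)
      rw [Finset.mem_product]
      refine ⟨hb', ?_⟩
      rw [mem_permsOn] at *
      intro i hi
      by_cases hib : i = b
      · subst hib; simp
      · have hi' : i ∉ insert b A := by simp [hib, hi]
        rw [Perm.mul_apply, swap_apply_of_ne_of_ne _ hib, hh i hi']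
        rintro rfl
        exact hi' hb'
    · rintro ⟨a, h⟩ hp
      rw [Finset.mem_product] at hp
      have hhb : h⁻¹ b = b := mem_permsOn.mp (inv_mem_permsOn hp.2) b hb
      have : (h * swap a b)⁻¹ b = a := by
        rw [_root_.mul_inv_rev, Perm.mul_apply, hhb]; simp
      simp only [this]
      simp [mul_assoc]
    · intro h hh
      simp [mul_assoc]
    · rintro ⟨a, h⟩ hp
      rw [Finset.mem_product] at hp
      simp only
      rw [mul_assoc, hg h hp.2]
  rw [← h2, Finset.sum_product] at h1
  simp only [Finset.sum_const, nsmul_eq_mul] at h1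
  rw [← Finset.mul_sum, Finset.sum_insert hb] at h1
  have hc : ((permsOn A).card : ℝ) ≠ 0 := by
    exact_mod_cast (Finset.card_pos.mpr ⟨1, one_mem_permsOn A⟩).ne'
  have h3 := (mul_eq_zero.mp h1).resolve_left hc
  simp only [swap_self, ← Perm.one_def, one_mul] at h3
  linarith

/-- Pairs inside A act trivially; each b outside A contributes −g for each of the two orders, by
`sum_swap_mul`. -/
theorem swapSumOn_eq {A U : Finset α} (hAU : A ⊆ U) {g : Perm α → ℝ}
    (hg : ∀ h ∈ permsOn A, ∀ x, g (h * x) = g x)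
    (h0 : ∀ b ∈ U \ A, symSum (insert b A) g = 0) :
    swapSumOn U g = ((A.card : ℝ) ^ 2 - 2 * ((U \ A).card : ℝ)) • g + swapSumOn (U \ A) g := by
  ext x
  simp only [swapSumOn_apply, Pi.add_apply, Pi.smul_apply, smul_eq_mul]
  have split : ∀ F : α → ℝ, ∑ i ∈ U, F i = ∑ i ∈ U \ A, F i + ∑ i ∈ A, F i :=
    fun F => (Finset.sum_sdiff hAU).symm
  have hAA : ∑ i ∈ A, ∑ j ∈ A, g (swap i j * x) = (A.card : ℝ) ^ 2 * g x := by
    have : ∀ i ∈ A, ∀ j ∈ A, g (swap i j * x) = g x := by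
      intro i hi j hj
      refine hg _ ?_ x
      rw [mem_permsOn]
      intro k hk
      exact swap_apply_of_ne_of_ne (fun h => hk (h ▸ hi)) (fun h => hk (h ▸ hj))
    rw [Finset.sum_congr rfl fun i hi => Finset.sum_congr rfl fun j hj => this i hi j hj]
    simp only [Finset.sum_const, nsmul_eq_mul]
    ring
  have hKA : ∑ i ∈ U \ A, ∑ j ∈ A, g (swap i j * x) = -(((U \ A).card : ℝ) * g x) := by
    have : ∀ i ∈ U \ A, ∑ j ∈ A, g (swap i j * x) = - g x := by
      intro i hi
      rw [← sum_swap_mul (Finset.mem_sdiff.mp hi).2 hg (h0 i hi) x]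
      exact Finset.sum_congr rfl fun j _ => by rw [Equiv.swap_comm]
    rw [Finset.sum_congr rfl this]
    simp
  have hAK : ∑ i ∈ A, ∑ j ∈ U \ A, g (swap i j * x) = -(((U \ A).card : ℝ) * g x) := by
    rw [Finset.sum_comm, ← hKA]
    exact Finset.sum_congr rfl fun i _ => Finset.sum_congr rfl fun j _ => by rw [Equiv.swap_comm]
  rw [split]
  simp only [fun i => split fun j => g (swap i j * x)]
  rw [Finset.sum_add_distrib, Finset.sum_add_distrib, hAA, hKA, hAK]
  ring

theorem eigenvalue_swapSumOn_le_sq {U : Finset α} {g : Perm α → ℝ} (hg : g ≠ 0) {μ : ℝ}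
    (h : swapSumOn U g = μ • g) : μ ≤ (U.card : ℝ) ^ 2 := by
  obtain ⟨x, -, hx⟩ := Finset.exists_max_image Finset.univ (fun x => |g x|) Finset.univ_nonempty
  have hpos : 0 < |g x| := by
    obtain ⟨y, hy⟩ := Function.ne_iff.mp hg
    exact (abs_pos.mpr hy).trans_le (hx y (Finset.mem_univ _))
  have h1 : |μ| * |g x| ≤ (U.card : ℝ) ^ 2 * |g x| := by
    have := congrFun h x
    rw [Pi.smul_apply, smul_eq_mul, swapSumOn_apply] at this
    rw [← abs_mul, ← this]
    calc _ ≤ ∑ i ∈ U, |∑ j ∈ U, g (swap i j * x)| := Finset.abs_sum_le_sum_abs _ _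
      _ ≤ ∑ i ∈ U, ∑ j ∈ U, |g (swap i j * x)| :=
        Finset.sum_le_sum fun i _ => Finset.abs_sum_le_sum_abs _ _
      _ ≤ ∑ i ∈ U, ∑ j ∈ U, |g x| :=
        Finset.sum_le_sum fun i _ => Finset.sum_le_sum fun j _ => hx _ (Finset.mem_univ _)
      _ = _ := by simp only [Finset.sum_const, nsmul_eq_mul]; ring
  exact (le_abs_self μ).trans (le_of_mul_le_mul_right h1 hpos)

/-- An eigenvector of the sum of the transpositions in `U` that is killed by the symmetrization over
each subset of size greater than `l`: its eigenvalue is at most the one for a first row of length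
`r ≤ l`. -/
theorem eigenvalue_swapSumOn_le (U : Finset α) (l : ℕ) (f : Perm α → ℝ) (hf : f ≠ 0) (μ : ℝ)
    (h : swapSumOn U f = μ • f) (hl : ∀ A ⊆ U, l < A.card → symSum A f = 0) :
    ∃ r : ℕ, r ≤ l ∧ r ≤ U.card ∧ μ ≤ r * U.card ∧
      μ ≤ (r : ℝ) ^ 2 + ((U.card : ℝ) - r) ^ 2 - 2 * ((U.card : ℝ) - r) := by
  induction hn : U.card using Nat.strong_induction_on generalizing U l f μ with
  | _ n ih =>
    subst hn
    have hne : (U.powerset.filter fun A => symSum A f ≠ 0).Nonempty := by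
      refine ⟨∅, ?_⟩
      have : permsOn (∅ : Finset α) = {1} := by
        ext g
        simp only [mem_permsOn, Finset.notMem_empty, not_false_eq_true, true_implies,
          Finset.mem_singleton]
        exact ⟨fun h => Equiv.ext h, fun h => by simp [h]⟩
      have h2 : symSum (∅ : Finset α) f = f := by
        ext x; simp [symSum_apply, this]
      simp [h2, hf]
    -- A largest set with nonzero symmetrization; its size is the witness r.
    obtain ⟨A, hA, hmax⟩ := Finset.exists_max_image _ Finset.card hne
    rw [Finset.mem_filter, Finset.mem_powerset] at hA
    obtain ⟨hAU, hA0⟩ := hA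
    have hbig : ∀ B ⊆ U, A.card < B.card → symSum B f = 0 := by
      intro B hB hc
      by_contra h0
      exact absurd (hmax B (by simp [hB, h0])) (by omega)
    have hAl : A.card ≤ l := by
      by_contra! hc
      exact hA0 (hl A hAU hc)
    have hcard : (U \ A).card + A.card = U.card := Finset.card_sdiff_add_card_eq_card hAU
    set g := symSum A f with hgdef
    have hS : swapSumOn U g = μ • g := by
      rw [hgdef, ← symSum_swapSumOn hAU, h, map_smul]
    have hK := swapSumOn_eq hAU (fun h hh x => symSum_mul hh f x) (g := g) (by
      intro b hb
      rw [Finset.mem_sdiff] at hb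
      refine symSum_symSum_of_subset (Finset.subset_insert _ _) (hbig _ ?_ ?_)
      · exact Finset.insert_subset hb.1 hAU
      · rw [Finset.card_insert_of_notMem hb.2]; omega)
    have hK' : swapSumOn (U \ A) g
        = (μ - ((A.card : ℝ) ^ 2 - 2 * ((U \ A).card : ℝ))) • g := by
      rw [sub_smul, ← hS, hK]; simp
    have hsq := eigenvalue_swapSumOn_le_sq hA0 hK'
    have hcR : ((U \ A).card : ℝ) = U.card - A.card := by
      rw [← hcard]; push_cast; ring
    -- The second bound uses only the trivial estimate |U \ A|² for the remaining transpositions.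
    refine ⟨A.card, hAl, by omega, ?_, by rw [hcR] at hsq; linarith⟩
    rcases Finset.eq_empty_or_nonempty U with rfl | ⟨a, ha⟩
    · have : A = ∅ := Finset.subset_empty.mp hAU
      subst this
      simp at hsq
      simpa using hsq
    · have hA1 : 0 < A.card := by
        by_contra hc
        have hf' := hbig {a} (by simpa using ha) (by rw [Finset.card_singleton]; omega)
        have : permsOn ({a} : Finset α) = {1} := by
          ext g
          rw [mem_permsOn, Finset.mem_singleton]
          refine ⟨fun h => Equiv.ext fun i => ?_, fun h => by simp [h]⟩
          by_cases hi : i = a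
          · subst hi
            by_contra hg
            have := h (g i) (by simpa using hg)
            exact hg (g.injective this)
          · exact h i (by simpa using hi)
        apply hf
        rw [← hf']
        ext x; simp [symSum_apply, this]
      -- The next row is no longer than A, so the remaining eigenvalue is at most |A|·|U \ A|, and
      -- |A|² + |A|·|U \ A| = |A|·|U|.
      obtain ⟨r, hr, -, hle, -⟩ := ih (U \ A).card (by omega) (U \ A) A.card g hA0 _ hK' (by
        intro B hB hc
        exact symSum_symSum_of_disjoint
          (Finset.disjoint_of_subset_right hB Finset.disjoint_sdiff)
          (hbig B (hB.trans Finset.sdiff_subset) hc)) rfl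
      have hr' : (r : ℝ) ≤ A.card := by exact_mod_cast hr
      have h0 : (0 : ℝ) ≤ (U \ A).card := by positivity
      have h3 : (r : ℝ) * (U \ A).card ≤ A.card * (U \ A).card :=
        mul_le_mul_of_nonneg_right hr' h0
      rw [hcR] at *
      nlinarith

end Levels

/-! ### Traces and counting of eigenvalues -/

section Spectral
variable {X : Type*} [Fintype X] [DecidableEq X] {A : Matrix X X ℝ} (hA : A.IsHermitian)
include hA

theorem trace_pow_eq_sum_eigenvalues (m : ℕ) :
    (A ^ m).trace = ∑ i, hA.eigenvalues i ^ m := by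
  conv_lhs => rw [hA.spectral_theorem]
  rw [← map_pow, Unitary.conjStarAlgAut_apply, Matrix.trace_mul_comm, ← mul_assoc, diagonal_pow]
  simp [trace_diagonal]

/-- If the quadratic form of `A` is at most `θ` times the square norm on a subspace given by
finitely many linear conditions, then at most that many eigenvalues are greater than `θ`. -/
theorem card_eigenvalues_gt_le {ι : Type*} [Fintype ι] (Φ : (X → ℝ) →ₗ[ℝ] (ι → ℝ)) (θ : ℝ)
    (h : ∀ f, Φ f = 0 → f ⬝ᵥ (A *ᵥ f) ≤ θ * (f ⬝ᵥ f)) :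
    (Finset.univ.filter fun i => θ < hA.eigenvalues i).card ≤ Fintype.card ι := by
  classical
  by_contra! hc
  set S := Finset.univ.filter fun i => θ < hA.eigenvalues i with hS
  let v : X → X → ℝ := fun i => (hA.eigenvectorBasis i : EuclideanSpace ℝ X)
  have hv : ∀ i j, v i ⬝ᵥ v j = if i = j then 1 else 0 := by
    intro i j
    have := (orthonormal_iff_ite.mp hA.eigenvectorBasis.orthonormal) i j
    rw [← this]
    simp [PiLp.inner_apply, dotProduct, v, mul_comm]
  have hAv : ∀ i, A *ᵥ v i = hA.eigenvalues i • v i := hA.mulVec_eigenvectorBasis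
  let L : (S → ℝ) →ₗ[ℝ] (X → ℝ) := Fintype.linearCombination ℝ (fun i : S => v i)
  have hL : ∀ a, L a = ∑ i : S, a i • v i := fun a => Fintype.linearCombination_apply ..
  -- Too many eigenvectors above θ would span a nonzero vector satisfying all the conditions.
  have hker : LinearMap.ker (Φ ∘ₗ L) ≠ ⊥ :=
    LinearMap.ker_ne_bot_of_finrank_lt (by simpa using hc)
  obtain ⟨a, ha, ha0⟩ := Submodule.exists_mem_ne_zero_of_ne_bot hker
  have hle := h (L a) (by simpa using ha)
  have dot : ∀ a b : S → ℝ, L a ⬝ᵥ L b = ∑ i, a i * b i := by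
    intro a b
    simp only [hL, sum_dotProduct, dotProduct_sum, smul_dotProduct, dotProduct_smul, hv,
      smul_eq_mul, mul_ite, mul_one, mul_zero]
    refine Finset.sum_congr rfl fun i _ => ?_
    rw [Finset.sum_eq_single i]
    · simp [mul_comm]
    · intro j _ hj
      rw [if_neg fun hij => hj (Subtype.ext hij)]
    · simp
  have hAL : A *ᵥ L a = L fun i => hA.eigenvalues i * a i := by
    rw [hL, hL, mulVec_sum]
    refine Finset.sum_congr rfl fun i _ => ?_
    rw [mulVec_smul, hAv, smul_smul, mul_comm]
  rw [hAL, dot, dot, Finset.mul_sum] at hle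
  obtain ⟨i, hi⟩ := Function.ne_iff.mp ha0
  refine absurd hle (not_le.mpr (Finset.sum_lt_sum (fun j _ => ?_) ⟨i, Finset.mem_univ _, ?_⟩))
  · have : θ < hA.eigenvalues j := (Finset.mem_filter.mp j.2).2
    nlinarith [mul_self_nonneg (a j)]
  · have h1 : θ < hA.eigenvalues i := (Finset.mem_filter.mp i.2).2
    have h2 : 0 < a i * a i := mul_self_pos.mpr hi
    nlinarith

theorem sum_eigenvalues_pow_le (hpos : ∀ i, 0 ≤ hA.eigenvalues i) (n : ℕ) (θ : ℕ → ℝ)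
    (hθ : ∀ k ≤ n, 0 ≤ θ k) (hθ0 : ∀ i, hA.eigenvalues i ≤ θ 0) (d : ℕ → ℕ)
    (hd : ∀ k < n, (Finset.univ.filter fun i => θ (k + 1) < hA.eigenvalues i).card ≤ d k)
    (hn : Fintype.card X ≤ d n) (m : ℕ) :
    ∑ i, hA.eigenvalues i ^ m ≤ ∑ k ∈ Finset.range (n + 1), d k * θ k ^ m := by
  classical
  let S : ℕ → Finset X := fun k =>
    if k < n then Finset.univ.filter fun i => θ (k + 1) < hA.eigenvalues i else Finset.univ
  have hS : ∀ i, ∃ k ∈ Finset.range (n + 1), i ∈ S k ∧ hA.eigenvalues i ≤ θ k := by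
    intro i
    -- Each eigenvalue is charged to the last k with λ ≤ θ k. No monotonicity of θ is required, and
    -- `levelBound` can indeed jump up where its formula changes.
    obtain ⟨k, hk, hmax⟩ := Finset.exists_max_image
      ((Finset.range (n + 1)).filter fun k => hA.eigenvalues i ≤ θ k) id ⟨0, by simp [hθ0 i]⟩
    rw [Finset.mem_filter] at hk
    refine ⟨k, hk.1, ?_, hk.2⟩
    by_cases hkn : k < n
    · simp only [S, hkn, if_true, Finset.mem_filter, Finset.mem_univ, true_and]
      by_contra! hc
      have := hmax (k + 1) (by simp [hkn, hc])
      simp at this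
    · simp [S, hkn]
  calc ∑ i, hA.eigenvalues i ^ m
      ≤ ∑ i, ∑ k ∈ Finset.range (n + 1), if i ∈ S k then θ k ^ m else 0 := by
        refine Finset.sum_le_sum fun i _ => ?_
        obtain ⟨k, hk, hik, hle⟩ := hS i
        refine le_trans ?_ (Finset.single_le_sum (fun k hk' => ?_) hk)
        · rw [if_pos hik]
          exact pow_le_pow_left₀ (hpos i) hle m
        · split_ifs
          · exact pow_nonneg (hθ k (Finset.mem_range_succ_iff.mp hk')) m
          · exact le_rfl
    _ = ∑ k ∈ Finset.range (n + 1), ((S k).card : ℝ) * θ k ^ m := by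
        rw [Finset.sum_comm]
        simp
    _ ≤ _ := by
        refine Finset.sum_le_sum fun k hk => ?_
        refine mul_le_mul_of_nonneg_right ?_
          (pow_nonneg (hθ k (Finset.mem_range_succ_iff.mp hk)) m)
        rw [Finset.mem_range] at hk
        by_cases hkn : k < n
        · simp only [S, hkn, if_true]
          exact_mod_cast hd k hkn
        · have : k = n := by omega
          subst this
          simp only [S, lt_irrefl, if_false, Finset.card_univ]
          exact_mod_cast hn

end Spectral

/-! ### Marginals and spectral bounds by level -/

/-- The linear conditions that define the functions orthogonal to all functions of the labels of
`k` positions. -/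
def marginals (n k : ℕ) : (Perm (Fin n) → ℝ) →ₗ[ℝ]
    ((Σ K : Finset.powersetCard k (Finset.univ : Finset (Fin n)), (K.1 ↪ Fin n)) → ℝ) :=
  LinearMap.pi fun p =>
    ∑ y ∈ Finset.univ.filter (fun y : Perm (Fin n) => ∀ c : p.1.1, y⁻¹ c = p.2 c),
      LinearMap.proj y

theorem marginals_apply (n k : ℕ) (f : Perm (Fin n) → ℝ)
    (p : Σ K : Finset.powersetCard k (Finset.univ : Finset (Fin n)), (K.1 ↪ Fin n)) :
    marginals n k f p
      = ∑ y ∈ Finset.univ.filter (fun y : Perm (Fin n) => ∀ c : p.1.1, y⁻¹ c = p.2 c), f y := by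
  simp [marginals]

theorem card_marginals (n k : ℕ) :
    Fintype.card (Σ K : Finset.powersetCard k (Finset.univ : Finset (Fin n)), (K.1 ↪ Fin n))
      = n.choose k * n.descFactorial k := by
  rw [Fintype.card_sigma]
  have : ∀ K : Finset.powersetCard k (Finset.univ : Finset (Fin n)),
      Fintype.card (K.1 ↪ Fin n) = n.descFactorial k := by
    intro K
    rw [Fintype.card_embedding_eq, Fintype.card_fin, Fintype.card_coe,
      (Finset.mem_powersetCard.mp K.2).2]
  simp [this]

/-- For |B| = n − k the orbit of `x` under permutations of B consists of all decks with the same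
cards as `x` outside B, so symmetrization over B is a marginal. Larger sets follow. -/
theorem symSum_eq_zero_of_marginals_eq_zero {n k : ℕ} (hk : k ≤ n) {f : Perm (Fin n) → ℝ}
    (hf : marginals n k f = 0) (A : Finset (Fin n)) (hA : n - k ≤ A.card) : symSum A f = 0 := by
  obtain ⟨B, hBA, hB⟩ := Finset.exists_subset_card_eq hA
  refine symSum_eq_zero_of_subset hBA ?_
  ext x
  have hK : Bᶜ ∈ Finset.powersetCard k (Finset.univ : Finset (Fin n)) := by
    rw [Finset.mem_powersetCard]
    refine ⟨Finset.subset_univ _, ?_⟩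
    rw [Finset.card_compl, hB, Fintype.card_fin]
    omega
  have h := congrFun hf ⟨⟨Bᶜ, hK⟩, (Function.Embedding.subtype _).trans x⁻¹.toEmbedding⟩
  rw [marginals_apply] at h
  rw [symSum_apply, Pi.zero_apply, ← Pi.zero_apply (M := fun _ => ℝ), ← h]
  refine Finset.sum_equiv (Equiv.mulRight x) (fun g => ?_) fun g _ => rfl
  simp only [mem_permsOn, Finset.mem_filter, Finset.mem_univ, true_and]
  constructor
  · intro hg c
    have hc : (c : Fin n) ∉ B := Finset.mem_compl.mp c.2
    have : g⁻¹ (c : Fin n) = c := by rw [Perm.inv_eq_iff_eq, hg _ hc]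
    simp only [coe_mulRight, _root_.mul_inv_rev, Perm.mul_apply, this]
    rfl
  · intro hg i hi
    have := hg ⟨i, by simpa using hi⟩
    simp only [coe_mulRight, _root_.mul_inv_rev, Perm.mul_apply] at this
    have h2 : g⁻¹ i = i := x⁻¹.injective this
    rw [Perm.inv_eq_iff_eq] at h2
    exact h2.symm

/-- Upper bound for the quadratic form of the random-to-random shuffle on the functions that are
orthogonal to all functions of the labels of less than `k` positions. -/
noncomputable def levelBound (n k : ℕ) : ℝ :=
  if 20 * k ≤ n then 1 - 0.9 * k / n else 1 - k / (2 * n)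

theorem levelBound_nonneg (n k : ℕ) (hk : k ≤ n) : 0 ≤ levelBound n k := by
  rcases Nat.eq_zero_or_pos n with rfl | hn
  · simp [levelBound]
  have hn' : (0 : ℝ) < n := by exact_mod_cast hn
  have hk' : (k : ℝ) ≤ n := by exact_mod_cast hk
  unfold levelBound
  split_ifs
  · rw [sub_nonneg, div_le_one hn']; linarith [(Nat.cast_nonneg k : (0 : ℝ) ≤ k)]
  · rw [sub_nonneg, div_le_one (by linarith)]; linarith

theorem swapSum_eq_swapSumOn (n : ℕ) (f : Perm (Fin n) → ℝ) :
    swapSum (Fin n) (Fin n) f = swapSumOn Finset.univ f := by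
  ext x
  simp only [swapSum, sumPullback_apply, swapSumOn_apply, Fintype.sum_prod_type]
  rfl

theorem swapSum_le_of_symSum_eq_zero {n k : ℕ} (hn : 0 < n) (hk : k ≤ n) (f : Perm (Fin n) → ℝ)
    (hf : ∀ A : Finset (Fin n), n - k < A.card → symSum A f = 0) :
    f ⬝ᵥ swapSum (Fin n) (Fin n) f ≤ (n : ℝ) ^ 2 * (2 * levelBound n k - 1) * (f ⬝ᵥ f) := by
  let W : Submodule ℝ (Perm (Fin n) → ℝ) :=
    ⨅ A : Finset (Fin n), ⨅ _ : n - k < A.card, LinearMap.ker (symSum A)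
  have hW : ∀ g, g ∈ W ↔ ∀ A : Finset (Fin n), n - k < A.card → symSum A g = 0 := by
    intro g; simp [W, Submodule.mem_iInf]
  refine dotProduct_le_of_eigenvalue_le (swapSum (Fin n) (Fin n)) swapSum_symm W ?_ _ ?_ f
    ((hW f).mpr hf)
  · intro g hg
    rw [hW] at *
    intro A hA
    rw [swapSum_eq_swapSumOn, symSum_swapSumOn (Finset.subset_univ _), hg A hA, map_zero]
  · intro g hg hg0 μ hμ
    rw [hW] at hg
    rw [swapSum_eq_swapSumOn] at hμ
    obtain ⟨r, hr, -, h1, h2⟩ := eigenvalue_swapSumOn_le Finset.univ (n - k) g hg0 μ hμ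
      fun A _ hA => hg A hA
    rw [Finset.card_univ, Fintype.card_fin] at h1 h2
    have hn' : (0 : ℝ) < n := by exact_mod_cast hn
    have hr0 : (0 : ℝ) ≤ r := Nat.cast_nonneg r
    have hk0 : (0 : ℝ) ≤ k := Nat.cast_nonneg k
    have hrk : (r : ℝ) + k ≤ n := by exact_mod_cast (by omega : r + k ≤ n)
    unfold levelBound
    split_ifs with hc
    · have hc' : 20 * (k : ℝ) ≤ n := by exact_mod_cast hc
      have e : (n : ℝ) ^ 2 * (2 * (1 - 0.9 * k / n) - 1) = n ^ 2 - 1.8 * n * k := by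
        field_simp; ring
      rw [e]
      -- Put j = n − r ≥ k. If j ≤ n/10, the second bound gives n² − 2nj + 2j² ≤ n² − 1.8nj.
      -- Otherwise rn = n² − nj < n² − 0.1n², while 1.8nk ≤ 0.09n².
      rcases le_or_gt (10 * ((n : ℝ) - r)) n with hj | hj
      · nlinarith
      · nlinarith
    · have e : (n : ℝ) ^ 2 * (2 * (1 - k / (2 * n)) - 1) = n ^ 2 - n * k := by
        field_simp; ring
      rw [e]
      nlinarith

/-! ### The transition matrix and its trace -/

theorem transition_apply (n : ℕ) (x y : Perm (Fin n)) :
    transition n x y = (∑ p : Fin n × Fin n, if relocate p.1 p.2 * x = y then (1 : ℝ) else 0)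
      / (n : ℝ) ^ 2 := by
  rw [transition, Finset.sum_boole]
  congr 2
  refine Finset.card_equiv (x.prodCongr (Equiv.refl _)) fun p => ?_
  rw [Finset.mem_filter, Finset.mem_filter]
  simp [moveCard]

theorem relocate_symm {n : ℕ} (p q : Fin n) : (relocate p q)⁻¹ = relocate q p := by
  cases n with
  | zero => exact p.elim0
  | succ n =>
    ext a : 1
    rw [Perm.inv_eq_iff_eq]
    simp [relocate]

theorem transition_isHermitian (n : ℕ) : (transition n).IsHermitian := by
  refine Matrix.IsHermitian.ext fun x y => ?_
  rw [transition_apply, transition_apply, star_trivial]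
  congr 1
  refine Fintype.sum_equiv (Equiv.prodComm _ _) _ _ fun p => ?_
  refine if_congr ?_ rfl rfl
  rw [← eq_inv_mul_iff_mul_eq, relocate_symm, eq_comm]
  rfl

theorem transition_mulVec (n : ℕ) (f : Perm (Fin n) → ℝ) :
    transition n *ᵥ f = (1 / (n : ℝ) ^ 2) • relocateSum (Fin n) n f := by
  ext x
  simp only [mulVec, dotProduct, transition_apply, Pi.smul_apply, relocateSum, sumPullback_apply,
    smul_eq_mul]
  simp only [div_mul_eq_mul_div, Finset.sum_mul, ← Finset.sum_div, one_mul]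
  rw [Finset.sum_comm]
  congr 1
  refine Finset.sum_congr rfl fun p _ => ?_
  simp only [ite_mul, one_mul, zero_mul, Finset.sum_ite_eq, Finset.mem_univ, if_true]
  rfl

theorem transition_mul_right (n : ℕ) (x y g : Perm (Fin n)) :
    transition n (x * g) (y * g) = transition n x y := by
  simp only [transition_apply, ← mul_assoc, mul_left_inj]

theorem transition_pow_mul_right (n m : ℕ) (x y g : Perm (Fin n)) :
    (transition n ^ m) (x * g) (y * g) = (transition n ^ m) x y := by
  induction m generalizing y with
  | zero => simp [Matrix.one_apply]
  | succ m ih =>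
    rw [pow_succ, Matrix.mul_apply, Matrix.mul_apply]
    symm
    refine Fintype.sum_equiv (Equiv.mulRight g) _ _ fun z => ?_
    simp [ih, transition_mul_right]

theorem transition_mulVec_one {n : ℕ} (hn : 0 < n) : transition n *ᵥ 1 = 1 := by
  rw [transition_mulVec]
  ext x
  have : (n : ℝ) ≠ 0 := by exact_mod_cast hn.ne'
  simp [relocateSum, sumPullback_apply]
  field_simp

theorem transition_pow_mulVec_one {n : ℕ} (hn : 0 < n) (t : ℕ) : (transition n ^ t) *ᵥ 1 = 1 := by
  induction t with
  | zero => simp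
  | succ t ih => rw [pow_succ, ← mulVec_mulVec, transition_mulVec_one hn, ih]

/-- Cauchy–Schwarz bounds the ℓ¹ distance by the ℓ² one, which symmetry of P turns into a diagonal
entry of P^(2t). Relabelling the cards makes the diagonal constant, so n! times that entry is the
trace. -/
theorem tvDist_sq_le {n : ℕ} (hn : 0 < n) (t : ℕ) (x : Perm (Fin n)) :
    4 * tvDist ((transition n ^ t) x) (uniform (Perm (Fin n))) ^ 2 ≤
      (transition n ^ (2 * t)).trace - 1 := by
  set M := transition n ^ t with hM
  set N : ℝ := ((Fintype.card (Perm (Fin n)) : ℕ) : ℝ) with hN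
  have hN0 : 0 < N := by rw [hN]; exact_mod_cast Fintype.card_pos
  have hrow : ∑ y, M x y = 1 := by
    have := congrFun (transition_pow_mulVec_one hn t) x
    simpa [mulVec, dotProduct] using this
  have hsymm : ∀ a b, M a b = M b a := fun a b => by
    have := ((transition_isHermitian n).pow t).apply b a
    simpa using this
  have hsq : ∑ y, M x y ^ 2 = (transition n ^ (2 * t)) x x := by
    rw [two_mul, pow_add, ← hM, Matrix.mul_apply]
    exact Finset.sum_congr rfl fun y _ => by rw [hsymm y x, sq]
  have htr : (transition n ^ (2 * t)).trace = N * (transition n ^ (2 * t)) x x := by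
    rw [Matrix.trace, hN, ← nsmul_eq_mul, ← Finset.card_univ, ← Finset.sum_const]
    refine Finset.sum_congr rfl fun y _ => ?_
    have := transition_pow_mul_right n (2 * t) x x (x⁻¹ * y)
    simpa using this
  have hcs : (∑ y, |M x y - 1 / N|) ^ 2 ≤ N * ∑ y, (M x y - 1 / N) ^ 2 := by
    have := sq_sum_le_card_mul_sum_sq (s := (Finset.univ : Finset (Perm (Fin n))))
      (f := fun y => |M x y - 1 / N|)
    simpa [hN] using this
  have hexp : N * ∑ y, (M x y - 1 / N) ^ 2 = (transition n ^ (2 * t)).trace - 1 := by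
    have : ∀ y, (M x y - 1 / N) ^ 2 = M x y ^ 2 - 2 / N * M x y + 1 / N ^ 2 := fun y => by ring
    simp only [this]
    rw [Finset.sum_add_distrib, Finset.sum_sub_distrib, ← Finset.mul_sum, hrow, hsq, htr,
      Finset.sum_const, nsmul_eq_mul, Finset.card_univ, ← hN]
    field_simp
    ring
  have : 4 * tvDist (M x) (uniform (Perm (Fin n))) ^ 2 = (∑ y, |M x y - 1 / N|) ^ 2 := by
    simp only [tvDist, uniform, ← hN]
    ring
  rw [this, ← hexp]
  exact hcs

theorem dotProduct_transition_mulVec_le {n k : ℕ} (hn : 0 < n) (hk : k ≤ n)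
    (f : Perm (Fin n) → ℝ)
    (hf : ∀ A : Finset (Fin n), n - k < A.card → symSum A f = 0) :
    f ⬝ᵥ (transition n *ᵥ f) ≤ levelBound n k * (f ⬝ᵥ f) := by
  have h1 := relocateSum_le_swapSum n f
  have h2 := swapSum_le_of_symSum_eq_zero hn hk f hf
  have hn' : (0 : ℝ) < (n : ℝ) ^ 2 := by positivity
  rw [transition_mulVec, dotProduct_smul, smul_eq_mul, one_div_mul_eq_div, div_le_iff₀ hn']
  linarith

theorem eigenvalues_transition_nonneg {n : ℕ} (i : Perm (Fin n)) :
    0 ≤ (transition_isHermitian n).eigenvalues i := by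
  refine Matrix.PosSemidef.eigenvalues_nonneg ?_ i
  refine Matrix.PosSemidef.of_dotProduct_mulVec_nonneg (transition_isHermitian n) fun f => ?_
  rw [star_trivial, transition_mulVec, dotProduct_smul, smul_eq_mul]
  cases n with
  | zero => simp
  | succ n =>
    rw [relocateSum_dotProduct_self]
    have : 0 ≤ insertSum (Fin (n + 1)) n f ⬝ᵥ insertSum (Fin (n + 1)) n f := by
      simpa using dotProduct_star_self_nonneg (insertSum (Fin (n + 1)) n f)
    positivity

theorem eigenvalues_transition_le_one {n : ℕ} (hn : 0 < n) (i : Perm (Fin n)) :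
    (transition_isHermitian n).eigenvalues i ≤ levelBound n 0 := by
  set v : Perm (Fin n) → ℝ :=
    ((transition_isHermitian n).eigenvectorBasis i).ofLp with hv
  have h := dotProduct_transition_mulVec_le hn (Nat.zero_le n) v fun A hA => by
    have := A.card_le_univ
    rw [Fintype.card_fin] at this
    omega
  have h1 : v ⬝ᵥ v = 1 := by
    have := (orthonormal_iff_ite.mp
      (transition_isHermitian n).eigenvectorBasis.orthonormal) i i
    rw [if_pos rfl, PiLp.inner_apply] at this
    simpa only [dotProduct, v, RCLike.inner_apply, conj_trivial] using this
  rw [hv, (transition_isHermitian n).mulVec_eigenvectorBasis, ← hv, dotProduct_smul, h1] at h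
  simpa using h

theorem trace_transition_pow_sub_one_le {n : ℕ} (hn : 0 < n) (m : ℕ) :
    (transition n ^ m).trace - 1 ≤ ∑ k ∈ Finset.range n,
      ((n.choose (k + 1) * n.descFactorial (k + 1) : ℕ) : ℝ) * levelBound n (k + 1) ^ m := by
  have h := sum_eigenvalues_pow_le (transition_isHermitian n) eigenvalues_transition_nonneg n
    (levelBound n) (levelBound_nonneg n) (eigenvalues_transition_le_one hn)
    (fun k => n.choose k * n.descFactorial k) (fun k hk => by
      rw [← card_marginals]
      refine card_eigenvalues_gt_le _ (marginals n k) _ fun f hf => ?_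
      refine dotProduct_transition_mulVec_le hn hk f fun A hA => ?_
      exact symSum_eq_zero_of_marginals_eq_zero hk.le hf A (by omega)) (by
      rw [Fintype.card_perm, Fintype.card_fin, Nat.descFactorial_self, Nat.choose_self, one_mul]) m
  rw [← trace_pow_eq_sum_eigenvalues, Finset.sum_range_succ'] at h
  have h0 : levelBound n 0 = 1 := by simp [levelBound]
  rw [h0] at h
  simp only [Nat.choose_zero_right, Nat.descFactorial_zero, mul_one, Nat.cast_one, one_pow] at h
  linarith

/-! ### Numerical estimates -/

/-- From k! ≥ (k/e)^k and log k ≥ log n − log 20, with log 20 ≤ 3. -/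
theorem exp_le_factorial {n k : ℕ} (hk : n < 20 * k) (hn : 0 < n) :
    Real.exp (k * (Real.log n - 4)) ≤ k.factorial := by
  have hk0 : (0 : ℝ) < k := by exact_mod_cast (by omega : 0 < k)
  have hn0 : (0 : ℝ) < n := by exact_mod_cast hn
  have h1 := Real.pow_div_factorial_le_exp (k : ℝ) hk0.le k
  rw [div_le_iff₀ (by positivity)] at h1
  have hlog : Real.log n - 3 ≤ Real.log k := by
    have h20 : Real.log 20 ≤ 3 := by
      rw [Real.log_le_iff_le_exp (by norm_num)]
      have h := Real.exp_one_gt_d9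
      calc (20 : ℝ) ≤ 2.7182818283 ^ 3 := by norm_num
        _ ≤ Real.exp 1 ^ 3 := by gcongr
        _ = Real.exp 3 := by rw [← Real.exp_nat_mul]; norm_num
    have h2 : Real.log n ≤ Real.log (20 * k) :=
      Real.log_le_log hn0 (by exact_mod_cast hk.le)
    rw [Real.log_mul (by norm_num) hk0.ne'] at h2
    linarith
  have h3 : (k : ℝ) ^ k = Real.exp (k * Real.log k) := by
    rw [Real.exp_nat_mul, Real.exp_log hk0]
  rw [h3] at h1
  have h4 : Real.exp (k * Real.log k) * Real.exp (-k) ≤ k.factorial := by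
    rw [Real.exp_neg, ← div_eq_mul_inv, div_le_iff₀ (Real.exp_pos _)]
    linarith
  rw [← Real.exp_add] at h4
  refine le_trans (Real.exp_le_exp.mpr ?_) h4
  nlinarith

theorem choose_mul_descFactorial_le {n : ℕ} (hn : 0 < n) (k : ℕ) :
    ((n.choose k * n.descFactorial k : ℕ) : ℝ)
      ≤ Real.exp (2 * k * Real.log n) / k.factorial := by
  have hn0 : (0 : ℝ) < n := by exact_mod_cast hn
  have h1 : ((n.descFactorial k : ℕ) : ℝ) ≤ (n : ℝ) ^ k := by
    exact_mod_cast Nat.descFactorial_le_pow n k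
  have h2 : ((n.choose k : ℕ) : ℝ) ≤ (n : ℝ) ^ k / k.factorial := Nat.choose_le_pow_div k n
  have h3 : (n : ℝ) ^ k = Real.exp (k * Real.log n) := by
    rw [Real.exp_nat_mul, Real.exp_log hn0]
  push_cast
  calc ((n.choose k : ℕ) : ℝ) * (n.descFactorial k : ℕ)
      ≤ (n : ℝ) ^ k / k.factorial * (n : ℝ) ^ k := by
        gcongr
    _ = _ := by
      rw [h3, div_mul_eq_mul_div, ← Real.exp_add]
      congr 2
      ring

theorem levelBound_pow_le {n k m : ℕ} (hkn : k ≤ n) {c : ℝ}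
    (hc : levelBound n k ≤ 1 - c) : levelBound n k ^ m ≤ Real.exp (-(m * c)) := by
  have h : levelBound n k ≤ Real.exp (-c) := by
    have := Real.add_one_le_exp (-c)
    linarith
  calc _ ≤ Real.exp (-c) ^ m := pow_le_pow_left₀ (levelBound_nonneg n k hkn) h m
    _ = _ := by rw [← Real.exp_nat_mul]; ring_nf

theorem level_term_le {n k m : ℕ} (hn : 0 < n) (hkn : k ≤ n)
    (hm : 3.06 * n * Real.log n ≤ m) :
    ((n.choose k * n.descFactorial k : ℕ) : ℝ) * levelBound n k ^ m
      ≤ Real.exp (4 - Real.log n / 2) ^ k := by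
  have hn0 : (0 : ℝ) < n := by exact_mod_cast hn
  have hL : 0 ≤ Real.log n := Real.log_natCast_nonneg n
  have hk0 : (0 : ℝ) ≤ k := Nat.cast_nonneg k
  have hkL : 0 ≤ (k : ℝ) * Real.log n := mul_nonneg hk0 hL
  have h1 := choose_mul_descFactorial_le hn k
  have h0 : 0 ≤ levelBound n k ^ m := pow_nonneg (levelBound_nonneg n k hkn) m
  rw [← Real.exp_nat_mul]
  have hm' : 3.06 * (k * Real.log n) ≤ m * (k / n) := by
    rw [← mul_div_assoc, le_div_iff₀ hn0]
    nlinarith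
  -- For small k the exponent is (2 − 0.9·3.06) k log n = −0.754 k log n.
  by_cases hc : 20 * k ≤ n
  · have h2 := levelBound_pow_le (n := n) (k := k) (m := m) hkn (c := 0.9 * (k / n)) (by
      rw [levelBound, if_pos hc, mul_div_assoc])
    have h3 : Real.exp (2 * k * Real.log n) / k.factorial ≤ Real.exp (2 * k * Real.log n) :=
      div_le_self (Real.exp_pos _).le (by exact_mod_cast k.factorial_pos)
    refine (mul_le_mul (h1.trans h3) h2 h0 (Real.exp_pos _).le).trans ?_
    rw [← Real.exp_add, Real.exp_le_exp]
    nlinarith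
  -- For large k the weaker rate is offset by k!: the exponent is k((2 − 1 − 1.53) log n + 4).
  · have h2 := levelBound_pow_le (n := n) (k := k) (m := m) hkn (c := (k / n) / 2) (by
      rw [levelBound, if_neg hc, div_div, mul_comm (n : ℝ)])
    have h3 : Real.exp (2 * k * Real.log n) / k.factorial
        ≤ Real.exp (2 * k * Real.log n) / Real.exp (k * (Real.log n - 4)) :=
      div_le_div_of_nonneg_left (Real.exp_pos _).le (Real.exp_pos _)
        (exp_le_factorial (by omega) hn)
    refine (mul_le_mul (h1.trans h3) h2 h0 (by positivity)).trans ?_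
    rw [← Real.exp_sub, ← Real.exp_add, Real.exp_le_exp]
    nlinarith

theorem tvDist_sq_le_exp {n t : ℕ} (hn : 0 < n) (ht : 3.06 * n * Real.log n ≤ 2 * t)
    (hρ : Real.exp (4 - Real.log n / 2) ≤ 1 / 2) (x : Perm (Fin n)) :
    tvDist ((transition n ^ t) x) (uniform (Perm (Fin n))) ^ 2
      ≤ Real.exp (4 - Real.log n / 2) := by
  set ρ := Real.exp (4 - Real.log n / 2) with hρdef
  have hρ0 : 0 < ρ := Real.exp_pos _
  have h1 := (tvDist_sq_le hn t x).trans (trace_transition_pow_sub_one_le hn (2 * t))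
  have h2 : ∑ k ∈ Finset.range n,
      ((n.choose (k + 1) * n.descFactorial (k + 1) : ℕ) : ℝ) * levelBound n (k + 1) ^ (2 * t)
      ≤ ∑ k ∈ Finset.range n, ρ * ρ ^ k := by
    refine Finset.sum_le_sum fun k hk => ?_
    rw [← pow_succ']
    exact level_term_le hn (Finset.mem_range.mp hk) (by push_cast; linarith)
  have h3 : ∑ k ∈ Finset.range n, ρ ^ k ≤ 2 := by
    have hs := summable_geometric_of_lt_one hρ0.le (by linarith : ρ < 1)
    refine (hs.sum_le_tsum _ fun k _ => by positivity).trans ?_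
    rw [tsum_geometric_of_lt_one hρ0.le (by linarith), inv_le_comm₀ (by linarith) (by norm_num)]
    linarith
  rw [← Finset.mul_sum] at h2
  nlinarith

end RandomToRandom

/-! ### The mixing time -/

theorem theorem1 (ε : ℝ) (hε : ε ∈ Set.Ioo (0 : ℝ) 1) :
    limsup (fun n : ℕ =>
      (RandomToRandom.mixingTime n ε : ℝ≥0∞) / ENNReal.ofReal (1.5324 * n * Real.log n))
      atTop ≤ 1 := by
  have hlog : Tendsto (fun n : ℕ => Real.log n) atTop atTop :=
    Real.tendsto_log_atTop.comp tendsto_natCast_atTop_atTop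
  have hρ : Tendsto (fun n : ℕ => Real.exp (4 - Real.log n / 2)) atTop (nhds 0) :=
    Real.tendsto_exp_atBot.comp (tendsto_atBot_add_const_left _ 4
      (tendsto_neg_atTop_atBot.comp (hlog.atTop_div_const (by norm_num : (0 : ℝ) < 2))))
  have hmin : (0 : ℝ) < min (1 / 2) (ε ^ 2) := lt_min (by norm_num) (pow_pos hε.1 2)
  refine limsup_le_of_le (h := ?_)
  filter_upwards [hρ.eventually (ge_mem_nhds hmin), hlog.eventually_ge_atTop 1,
    eventually_ge_atTop 1000] with n h1 h2 h3
  have hn : 0 < n := by omega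
  have hn' : (1000 : ℝ) ≤ n := by exact_mod_cast h3
  set T : ℝ := 1.5324 * n * Real.log n with hT
  -- Rounding down costs less than 2 in `2 * t`, absorbed by (2·1.5324 − 3.06) n log n = 0.0048 n
  -- log n ≥ 4.8.
  have hnL : (1000 : ℝ) ≤ n * Real.log n := by nlinarith
  have hT' : T = 1.5324 * (n * Real.log n) := by rw [hT]; ring
  have hT0 : 0 ≤ T := by linarith
  have ht : T < (⌊T⌋₊ : ℝ) + 1 := Nat.lt_floor_add_one T
  have hmix : RandomToRandom.mixingTime n ε ≤ (⌊T⌋₊ : ℕ∞) := by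
    refine iInf₂_le ⌊T⌋₊ fun x => ?_
    have h := RandomToRandom.tvDist_sq_le_exp (t := ⌊T⌋₊) hn (by linarith)
      (h1.trans (min_le_left _ _)) x
    exact (abs_le_of_sq_le_sq' (h.trans (h1.trans (min_le_right _ _))) hε.1.le).2
  have hcast : (RandomToRandom.mixingTime n ε : ℝ≥0∞) ≤ ENNReal.ofReal T := by
    calc (RandomToRandom.mixingTime n ε : ℝ≥0∞) ≤ ((⌊T⌋₊ : ℕ∞) : ℝ≥0∞) :=
          ENat.toENNReal_le.mpr hmix
      _ = ENNReal.ofReal (⌊T⌋₊ : ℝ) := by simp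
      _ ≤ ENNReal.ofReal T := ENNReal.ofReal_le_ofReal (Nat.floor_le hT0)
  exact ENNReal.div_le_of_le_mul (by simpa using hcast)
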